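/- For an integer $i\ge 1$, let $\Sigma_i$ (respectively $\Pi_i$) be the set of first-order formulas in negation normal form (not necessarily prenex) in which every sequence of nested quantifiers begins with $\exists$ (respectively $\forall$) and has at most $i-1$ quantifier alternations. A $c$-colored graph is a finite simple undirected graph in which every vertex has one of $c$ colors; it is regarded as a structure with a binary adjacency relation and $c$ unary color relations, and formulas may also use equality. For colored graphs $G$ and $H$ and a fragment $\mathcal L$, let $D^2_{\mathcal L}(G,H)$ be the minimum quantifier depth of a sentence in $\mathcal L$ that uses at most two variables (which may be requantified), is true on $G$ and is false on $H$; put $D^2_{\mathcal L}(G,H)=\infty$ if there is no such sentence. There is a constant number of colors $c$ such that the following holds. For every $i\ge 2$ there are constants $K$ and $\varepsilon>0$, depending only on $i$, such that for infinitely many $n$ there are $c$-colored graphs $G$ and $H$, both with $n$ vertices, satisfying $$D^2_{\Sigma_i}(G,H)\le K,\qquad D^2_{\Sigma_{i-1}}(G,H)<\infty,\qquad D^2_{\Pi_i}(G,H)\ge \varepsilon n^2 .$$ -/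

import Mathlib

open scoped ENNReal

namespace AltHier

/-- A finite or infinite simple graph on `V` whose vertices are colored with `c` colors,
viewed as a structure with a binary adjacency relation and one unary relation per color. -/
structure ColoredGraph (c : ℕ) (V : Type*) where
  graph : SimpleGraph V
  color : V → Fin c

/-- The two kinds of quantifiers. -/
inductive Quantifier where
  | ex
  | all
  deriving DecidableEq

/-- Atomic formulas over the vocabulary of `c`-colored graphs in the variables `x₀, …, x_{k-1}`. -/
inductive Atom (c k : ℕ) where
  | color (j : Fin c) (x : Fin k)
  | adj (x y : Fin k)
  | eq (x y : Fin k)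

/-- First-order formulas in negation normal form using only `k` variables. Variables may be
quantified repeatedly. -/
inductive Formula (c k : ℕ) where
  | pos (a : Atom c k)
  | neg (a : Atom c k)
  | and (φ ψ : Formula c k)
  | or (φ ψ : Formula c k)
  | quant (Q : Quantifier) (x : Fin k) (φ : Formula c k)

/-- The variables occurring in an atomic formula. -/
def Atom.vars {c k : ℕ} : Atom c k → Finset (Fin k)
  | .color _ x => {x}
  | .adj x y => {x, y}
  | .eq x y => {x, y}

/-- Truth of an atomic formula under an assignment. -/
def Atom.Holds {c k : ℕ} {V : Type*} (G : ColoredGraph c V) (v : Fin k → V) : Atom c k → Prop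
  | .color j x => G.color (v x) = j
  | .adj x y => G.graph.Adj (v x) (v y)
  | .eq x y => v x = v y

namespace Formula

/-- The free variables of a formula. -/
def freeVars {c k : ℕ} : Formula c k → Finset (Fin k)
  | pos a => a.vars
  | neg a => a.vars
  | and φ ψ => φ.freeVars ∪ ψ.freeVars
  | or φ ψ => φ.freeVars ∪ ψ.freeVars
  | quant _ x φ => φ.freeVars.erase x

/-- Truth of a formula under an assignment. -/
def Holds {c k : ℕ} {V : Type*} (G : ColoredGraph c V) : (Fin k → V) → Formula c k → Prop
  | v, pos a => a.Holds G v
  | v, neg a => ¬ a.Holds G v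
  | v, and φ ψ => φ.Holds G v ∧ ψ.Holds G v
  | v, or φ ψ => φ.Holds G v ∨ ψ.Holds G v
  | v, quant .ex x φ => ∃ w : V, φ.Holds G (Function.update v x w)
  | v, quant .all x φ => ∀ w : V, φ.Holds G (Function.update v x w)

/-- Quantifier depth. -/
def depth {c k : ℕ} : Formula c k → ℕ
  | pos _ => 0
  | neg _ => 0
  | and φ ψ => max φ.depth ψ.depth
  | or φ ψ => max φ.depth ψ.depth
  | quant _ _ φ => φ.depth + 1

/-- Every sequence of nested quantifiers of the formula, read from the outside,
begins with the quantifier `Q` (or is empty). -/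
def BeginsWith {c k : ℕ} (Q : Quantifier) : Formula c k → Prop
  | pos _ => True
  | neg _ => True
  | and φ ψ => φ.BeginsWith Q ∧ ψ.BeginsWith Q
  | or φ ψ => φ.BeginsWith Q ∧ ψ.BeginsWith Q
  | quant Q' _ _ => Q' = Q

/-- `altAfter Q φ` is the maximum number of quantifier alternations in a sequence
`Q, Q₁, …, Q_r`, where `Q₁, …, Q_r` is a sequence of nested quantifiers of `φ`. -/
def altAfter {c k : ℕ} : Quantifier → Formula c k → ℕ
  | _, pos _ => 0
  | _, neg _ => 0
  | Q, and φ ψ => max (φ.altAfter Q) (ψ.altAfter Q)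
  | Q, or φ ψ => max (φ.altAfter Q) (ψ.altAfter Q)
  | Q, quant Q' _ φ => (if Q' = Q then 0 else 1) + φ.altAfter Q'

end Formula

/-- The formulas with `k` variables in which every sequence of nested quantifiers begins with `Q`
and has fewer than `i` (that is, at most `i - 1`) alternations, for `i ≥ 1`. Prefixing such a
sequence with a further `Q` does not change its number of alternations. -/
def level (c k : ℕ) (Q : Quantifier) (i : ℕ) : Set (Formula c k) :=
  {φ | φ.BeginsWith Q ∧ φ.altAfter Q < i}

/-- The fragment `Σ_i ∩ FO^k`, for `i ≥ 1`. -/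
def SigmaLevel (c k i : ℕ) : Set (Formula c k) := level c k .ex i

/-- The fragment `Π_i ∩ FO^k`, for `i ≥ 1`. -/
def PiLevel (c k i : ℕ) : Set (Formula c k) := level c k .all i

/-- `φ` is a sentence that is true on `G` and false on `H`. For a sentence the assignment does not
matter. -/
def Distinguishes {c k : ℕ} {V W : Type*} (φ : Formula c k)
    (G : ColoredGraph c V) (H : ColoredGraph c W) : Prop :=
  φ.freeVars = ∅ ∧ (∀ v : Fin k → V, φ.Holds G v) ∧ (∀ w : Fin k → W, ¬ φ.Holds H w)

/-- The minimum quantifier depth of a sentence in the fragment `L` distinguishing `G` from `H`;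
it is `⊤` if there is no such sentence. -/
noncomputable def distDepth {c k : ℕ} {V W : Type*} (L : Set (Formula c k))
    (G : ColoredGraph c V) (H : ColoredGraph c W) : ℕ∞ :=
  ⨅ φ ∈ {φ : Formula c k | φ ∈ L ∧ Distinguishes φ G H}, (φ.depth : ℕ∞)

end AltHier

/-!
The two graphs are binary trees of height `m` with a gadget attached to every node. The type of a
node is `true` if and only if it is a second child of a node of type `false`, so that
`type s = false ↔ ∃ child s', type s' = true` and one quantifier alternation is spent per level to
trace the type of the root down to the leaves, where alone the gadget depends on the type. Spoiler
has to start in the right graph for this: starting in the other one he needs one more alternation,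
and without it he reaches the leaves playing from the gadget for `true`, never from the one for
`false`.

The gadget consists of a cycle of length `3p` with, for the type `true`, a marked vertex, and of a
cycle of length `3q` in which every vertex except one comes in a marked and an unmarked version;
`p` and `q` are coprime and the colors give orientations. One alternation inside the gadget finds a
vertex without marked successor at once. Without it, Spoiler can only walk around the first cycle
while Duplicator walks around the second one, and she is caught only if the vertex `0` of both
cycles is reached at the same time, which takes a quadratic number of steps from a good
starting point.
-/

namespace AltHier

variable {c k : ℕ}

/-! ### Negation normal form and alternations -/

/-- The dual quantifier, by which negation replaces a quantifier. -/
def Quantifier.dual : Quantifier → Quantifier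
  | .ex => .all
  | .all => .ex

namespace Formula

/-- The negation of a formula, in negation normal form. -/
def dual : Formula c k → Formula c k
  | pos a => neg a
  | neg a => pos a
  | and φ ψ => or φ.dual ψ.dual
  | or φ ψ => and φ.dual ψ.dual
  | quant Q x φ => quant Q.dual x φ.dual

theorem holds_dual {V : Type*} (G : ColoredGraph c V) (φ : Formula c k) (v : Fin k → V) :
    φ.dual.Holds G v ↔ ¬ φ.Holds G v := by
  induction φ generalizing v with
  | pos a => rfl
  | neg a => exact not_not.symm
  | and φ ψ ihφ ihψ => simp only [dual, Holds, ihφ, ihψ, not_and_or]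
  | or φ ψ ihφ ihψ => simp only [dual, Holds, ihφ, ihψ, not_or]
  | quant Q x φ ih => cases Q <;> simp [dual, Quantifier.dual, Holds, ih]

theorem freeVars_dual (φ : Formula c k) : φ.dual.freeVars = φ.freeVars := by
  induction φ with
  | pos a | neg a => rfl
  | and φ ψ ihφ ihψ | or φ ψ ihφ ihψ => simp only [dual, freeVars, ihφ, ihψ]
  | quant Q x φ ih => simp only [dual, freeVars, ih]

theorem altAfter_dual (φ : Formula c k) (Q : Quantifier) :
    φ.dual.altAfter Q = φ.altAfter Q.dual := by
  induction φ generalizing Q with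
  | pos a | neg a => rfl
  | and φ ψ ihφ ihψ | or φ ψ ihφ ihψ => simp only [dual, altAfter, ihφ, ihψ]
  | quant Q' x φ ih =>
    cases Q <;> cases Q' <;> simp [dual, altAfter, ih, Quantifier.dual]

end Formula

/-! ### Modal formulas -/

/-- Formulas of modal logic over `c`-colored graphs. They are a convenient source of formulas with
two variables. `dia j φ` says that some neighbor of color `j` satisfies `φ`. -/
inductive Modal (c : ℕ) where
  | top
  | neg (φ : Modal c)
  | dia (j : Fin c) (φ : Modal c)

namespace Modal

/-- Truth of a modal formula at a vertex. -/
def Sat {V : Type*} (G : ColoredGraph c V) : Modal c → V → Prop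
  | top, _ => True
  | neg φ, u => ¬ φ.Sat G u
  | dia j φ, u => ∃ w, G.graph.Adj u w ∧ G.color w = j ∧ φ.Sat G w

/-- `φ.Realized j G` says that `φ` is true at some vertex of `G` of color `j`. -/
def Realized {V : Type*} (φ : Modal c) (j : Fin c) (G : ColoredGraph c V) : Prop :=
  ∃ u, G.color u = j ∧ φ.Sat G u

/-- The maximum number of alternations in a sequence `Q, Q₁, …, Q_r`, where `Q₁, …, Q_r` is a
sequence of nested quantifiers of the standard translation of the formula. -/
def altAfter : Quantifier → Modal c → ℕ
  | _, top => 0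
  | Q, neg φ => φ.altAfter Q.dual
  | Q, dia _ φ => (if .ex = Q then 0 else 1) + φ.altAfter .ex

/-- The standard translation of a modal formula: a formula with the free variable `x`. -/
def toFormula : Modal c → Fin 2 → Formula c 2
  | top, x => .pos (.eq x x)
  | neg φ, x => (φ.toFormula x).dual
  | dia j φ, x => .quant .ex (x + 1)
      (.and (.pos (.adj x (x + 1))) (.and (.pos (.color j (x + 1))) (φ.toFormula (x + 1))))

theorem holds_toFormula {V : Type*} (G : ColoredGraph c V) (φ : Modal c) (x : Fin 2)
    (v : Fin 2 → V) : (φ.toFormula x).Holds G v ↔ φ.Sat G (v x) := by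
  induction φ generalizing x v with
  | top => simp [toFormula, Formula.Holds, Atom.Holds, Sat]
  | neg φ ih => rw [toFormula, Formula.holds_dual, ih, Sat]
  | dia j φ ih => simp [toFormula, Formula.Holds, Atom.Holds, Sat, ih]

theorem freeVars_toFormula_subset (φ : Modal c) (x : Fin 2) : (φ.toFormula x).freeVars ⊆ {x} := by
  induction φ generalizing x with
  | top => simp [toFormula, Formula.freeVars, Atom.vars]
  | neg φ ih => rw [toFormula, Formula.freeVars_dual]; exact ih x
  | dia j φ ih =>
    intro y hy
    have hφ := @ih (x + 1) y
    simp only [toFormula, Formula.freeVars, Atom.vars, Finset.mem_erase, Finset.mem_union,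
      Finset.mem_insert, Finset.mem_singleton] at hy hφ ⊢
    tauto

theorem altAfter_toFormula (φ : Modal c) (x : Fin 2) (Q : Quantifier) :
    (φ.toFormula x).altAfter Q = φ.altAfter Q := by
  induction φ generalizing x Q with
  | top => rfl
  | neg φ ih => rw [toFormula, Formula.altAfter_dual, ih, altAfter]
  | dia j φ ih => simp [toFormula, Formula.altAfter, altAfter, ih]

/-- The sentence expressing `φ.Realized j`. -/
def toSentence (φ : Modal c) (j : Fin c) : Formula c 2 :=
  .quant .ex 0 (.and (.pos (.color j 0)) (φ.toFormula 0))

theorem freeVars_toSentence (φ : Modal c) (j : Fin c) : (φ.toSentence j).freeVars = ∅ := by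
  have hφ := φ.freeVars_toFormula_subset 0
  rw [toSentence, Formula.freeVars, ← Finset.subset_empty, ← Finset.subset_insert_iff,
    Formula.freeVars, Formula.freeVars, Atom.vars]
  exact Finset.union_subset subset_rfl hφ

theorem holds_toSentence {V : Type*} (G : ColoredGraph c V) (φ : Modal c) (j : Fin c)
    (v : Fin 2 → V) : (φ.toSentence j).Holds G v ↔ φ.Realized j G := by
  simp [toSentence, Formula.Holds, Atom.Holds, holds_toFormula, Realized]

theorem distDepth_sigmaLevel_le {V W : Type*} {G : ColoredGraph c V} {H : ColoredGraph c W}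
    {φ : Modal c} {j : Fin c} (hG : φ.Realized j G) (hH : ¬ φ.Realized j H) {i : ℕ}
    (hi : φ.altAfter .ex < i) :
    distDepth (SigmaLevel c 2 i) G H ≤ ((φ.toSentence j).depth : ℕ∞) := by
  refine iInf₂_le _ ⟨⟨rfl, ?_⟩, φ.freeVars_toSentence j, fun v => ?_, fun v => ?_⟩
  · simpa [toSentence, Formula.altAfter, altAfter_toFormula] using hi
  · exact (holds_toSentence G φ j v).2 hG
  · rwa [holds_toSentence]

/-- Renaming the colors in a modal formula. -/
def relabel {d : ℕ} (f : Fin c → Fin d) : Modal c → Modal d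
  | top => top
  | neg φ => neg (φ.relabel f)
  | dia j φ => dia (f j) (φ.relabel f)

theorem altAfter_relabel {d : ℕ} (f : Fin c → Fin d) (φ : Modal c) (Q : Quantifier) :
    (φ.relabel f).altAfter Q = φ.altAfter Q := by
  induction φ generalizing Q with
  | top => rfl
  | neg _ ih => exact ih _
  | dia j φ ih => simp only [relabel, altAfter, ih]

end Modal

/-! ### The two-pebble game -/

/-- `R` describes a winning strategy of Duplicator in the two-pebble games on pairs of the graphs
`M b`: `R b b' a t u v` means that the pebbles on `u` and `v` may be left in place with `t` rounds
to come, when Spoiler is going to play in `M b` and may change to the other graph `a` times. In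
`move`, Spoiler puts the second pebble on `u'`. -/
structure IsStrategy {ι : Type*} {V : ι → Type*} (M : ∀ b, ColoredGraph c (V b))
    (R : ∀ b b', ℕ → ℕ → V b → V b' → Prop) : Prop where
  swap : ∀ {b b' a t u v}, R b b' (a + 1) t u v → R b' b a t v u
  color_eq : ∀ {b b' a t u v}, R b b' a t u v → (M b).color u = (M b').color v
  move : ∀ {b b' a t u v}, R b b' a (t + 1) u v → ∀ u', ∃ v', (u' = u ↔ v' = v) ∧
    ((M b).graph.Adj u u' ↔ (M b').graph.Adj v v') ∧ R b b' a t u' v'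

namespace IsStrategy

variable {ι : Type*} {V : ι → Type*} {M : ∀ b, ColoredGraph c (V b)}
  {R : ∀ b b', ℕ → ℕ → V b → V b' → Prop} {b b' : ι} {a t : ℕ} {v : Fin 2 → V b} {v' : Fin 2 → V b'}

theorem of_succ (hR : IsStrategy M R) {u : V b} {w : V b'} (h : R b b' a (t + 1) u w) :
    R b b' a t u w := by
  obtain ⟨w', heq, -, hw'⟩ := hR.move h u
  exact heq.1 rfl ▸ hw'

variable (M R) in
/-- A position of the game, given by two assignments, that is safe for Duplicator. -/
structure Safe (b b' : ι) (a t : ℕ) (v : Fin 2 → V b) (v' : Fin 2 → V b') : Prop where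
  rel : ∀ x, R b b' a t (v x) (v' x)
  eq_iff : ∀ x y, v x = v y ↔ v' x = v' y
  adj_iff : ∀ x y, (M b).graph.Adj (v x) (v y) ↔ (M b').graph.Adj (v' x) (v' y)

theorem Safe.swap (hR : IsStrategy M R) (h : Safe M R b b' (a + 1) t v v') :
    Safe M R b' b a t v' v :=
  ⟨fun x => hR.swap (h.rel x), fun x y => (h.eq_iff x y).symm, fun x y => (h.adj_iff x y).symm⟩

theorem Safe.holds_atom_iff (hR : IsStrategy M R) (h : Safe M R b b' a t v v') (A : Atom c 2) :
    A.Holds (M b) v ↔ A.Holds (M b') v' := by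
  cases A with
  | color j x => rw [Atom.Holds, Atom.Holds, hR.color_eq (h.rel x)]
  | adj x y => exact h.adj_iff x y
  | eq x y => exact h.eq_iff x y

theorem Safe.exists_update (hR : IsStrategy M R) (h : Safe M R b b' a (t + 1) v v') (x : Fin 2)
    (w : V b) : ∃ w', Safe M R b b' a t (Function.update v x w) (Function.update v' x w') := by
  have hcases : ∀ x y : Fin 2, y = x ∨ y = x + 1 := by decide
  obtain ⟨w', heq, hadj, hw⟩ := hR.move (h.rel (x + 1)) w
  replace hcases := hcases x
  have hkept := hR.of_succ (h.rel (x + 1))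
  refine ⟨w', fun y => ?_, fun y z => ?_, fun y z => ?_⟩
  · rcases hcases y with rfl | rfl <;> simpa
  · rcases hcases y with rfl | rfl <;> rcases hcases z with hz | hz <;> subst hz <;>
      simp [heq, eq_comm (a := v (_ + 1)), eq_comm (a := v' (_ + 1))]
  · rcases hcases y with rfl | rfl <;> rcases hcases z with hz | hz <;> subst hz <;>
      simp [hadj, SimpleGraph.adj_comm _ w, SimpleGraph.adj_comm _ w']

theorem Safe.holds (hR : IsStrategy M R) (φ : Formula c 2) (h : Safe M R b b' a t v v')
    (ht : φ.depth ≤ t) :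
    (φ.altAfter .ex ≤ a → φ.Holds (M b) v → φ.Holds (M b') v') ∧
      (φ.altAfter .all ≤ a → φ.Holds (M b') v' → φ.Holds (M b) v) := by
  induction φ generalizing b b' a t with
  | pos A => simp [Formula.Holds, h.holds_atom_iff hR A]
  | neg A => simp [Formula.Holds, h.holds_atom_iff hR A]
  | and φ ψ ihφ ihψ | or φ ψ ihφ ihψ =>
    simp only [Formula.depth, Formula.altAfter, Formula.Holds, sup_le_iff] at ht ⊢
    have hφ := ihφ h ht.1
    have hψ := ihψ h ht.2
    tauto
  | quant Q x φ ih =>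
    obtain ⟨t, rfl⟩ := Nat.exists_eq_add_of_le' (Nat.le_trans (Nat.le_add_left 1 _) ht)
    replace ht := Nat.le_of_succ_le_succ ht
    cases Q <;> simp only [Formula.altAfter, Formula.Holds, reduceCtorEq, if_true, if_false,
      zero_add]
    case ex =>
      refine ⟨fun ha ⟨w, hw⟩ => ?_, fun ha ⟨w, hw⟩ => ?_⟩
      · obtain ⟨w', hsafe⟩ := h.exists_update hR x w
        exact ⟨w', (ih hsafe ht).1 ha hw⟩
      · obtain ⟨a, rfl⟩ := Nat.exists_eq_add_of_le ha
        rw [add_assoc, add_comm] at h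
        obtain ⟨w', hsafe⟩ := (h.swap hR).exists_update hR x w
        exact ⟨w', (ih hsafe ht).1 (Nat.le_add_right _ _) hw⟩
    case all =>
      refine ⟨fun ha hw w => ?_, fun ha hw w => ?_⟩
      · obtain ⟨a, rfl⟩ := Nat.exists_eq_add_of_le ha
        rw [add_assoc, add_comm] at h
        obtain ⟨w', hsafe⟩ := (h.swap hR).exists_update hR x w
        exact (ih hsafe ht).2 (Nat.le_add_right _ _) (hw w')
      · obtain ⟨w', hsafe⟩ := h.exists_update hR x w
        exact (ih hsafe ht).2 ha (hw w')

theorem lt_distDepth_piLevel (hR : IsStrategy M R) {u : V b} {w : V b'} (h : R b b' a t u w) :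
    (t : ℕ∞) < distDepth (PiLevel c 2 (a + 1)) (M b') (M b) := by
  refine (ENat.add_one_le_iff (ENat.natCast_ne_top t)).1 (le_iInf₂ fun φ hφ => ?_)
  obtain ⟨⟨-, ha⟩, -, htrue, hfalse⟩ := hφ
  by_contra! hlt
  have ht : φ.depth ≤ t := Nat.le_of_lt_succ (by exact_mod_cast hlt)
  have hsafe : Safe M R b b' a t (fun _ => u) (fun _ => w) :=
    ⟨fun _ => h, by simp, by simp⟩
  exact hfalse _ ((hsafe.holds hR φ ht).2 (Nat.le_of_lt_succ ha) (htrue _))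

end IsStrategy

/-! ### Isomorphic copies and simulations -/

namespace ColoredGraph

variable {V W : Type*}

/-- The colored graph on `W` obtained by pulling back adjacency and colors along `f`. -/
def comap (f : W → V) (G : ColoredGraph c V) : ColoredGraph c W where
  graph := G.graph.comap f
  color := G.color ∘ f

theorem holds_comap (e : W ≃ V) (G : ColoredGraph c V) (φ : Formula c k) (v : Fin k → W) :
    φ.Holds (G.comap e) v ↔ φ.Holds G (e ∘ v) := by
  induction φ generalizing v with
  | pos A | neg A => cases A <;> simp [Formula.Holds, Atom.Holds, comap]
  | and φ ψ ihφ ihψ | or φ ψ ihφ ihψ => simp only [Formula.Holds, ihφ, ihψ]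
  | quant Q x φ ih =>
    cases Q <;> simp only [Formula.Holds, ih, Function.comp_update]
    · exact e.exists_congr_left.trans (by simp)
    · exact e.forall_congr_left.trans (by simp)

theorem distinguishes_comap_iff (e : W ≃ V) (G H : ColoredGraph c V) (φ : Formula c k) :
    Distinguishes φ (G.comap e) (H.comap e) ↔ Distinguishes φ G H := by
  simp only [Distinguishes, holds_comap,
    (e.surjective.comp_left (α := Fin k)).forall (p := fun v => φ.Holds G v),
    (e.surjective.comp_left (α := Fin k)).forall (p := fun v => ¬ φ.Holds H v)]

theorem distDepth_comap (e : W ≃ V) (L : Set (Formula c k)) (G H : ColoredGraph c V) :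
    distDepth L (G.comap e) (H.comap e) = distDepth L G H := by
  simp only [distDepth, distinguishes_comap_iff]

/-- `G.Sim H t u v` says that every walk of length `t` in `G` that starts at `u` can be imitated
step by step, respecting the colors, by a walk in `H` that starts at `v`. -/
def Sim (G : ColoredGraph c V) (H : ColoredGraph c W) : ℕ → V → W → Prop
  | 0, u, v => G.color u = H.color v
  | t + 1, u, v => G.color u = H.color v ∧
      ∀ u', G.graph.Adj u u' → ∃ v', H.graph.Adj v v' ∧ G.Sim H t u' v'

variable {G : ColoredGraph c V} {H : ColoredGraph c W}

theorem Sim.color_eq {t : ℕ} {u : V} {v : W} (h : G.Sim H t u v) : G.color u = H.color v := by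
  cases t with
  | zero => exact h
  | succ t => exact h.1

theorem sim_refl (G : ColoredGraph c V) (t : ℕ) (u : V) : G.Sim G t u u := by
  induction t generalizing u with
  | zero => rfl
  | succ t ih => exact ⟨rfl, fun u' hu' => ⟨u', hu', ih u'⟩⟩

theorem Sim.anti {s t : ℕ} (hst : s ≤ t) {u : V} {v : W} (h : G.Sim H t u v) :
    G.Sim H s u v := by
  induction s generalizing t u v with
  | zero => exact h.color_eq
  | succ s ih =>
    obtain ⟨t, rfl⟩ := Nat.exists_eq_add_of_le' (Nat.le_trans (Nat.le_add_left 1 s) hst)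
    refine ⟨h.1, fun u' hu' => ?_⟩
    obtain ⟨v', hv', h'⟩ := h.2 u' hu'
    exact ⟨v', hv', ih (Nat.le_of_succ_le_succ hst) h'⟩

end ColoredGraph

/-! ### Trees of gadgets -/

/-- The type of a node of the infinite binary tree, if the type of the root is `b`. A node is given
by the bits on the path to it, the last one coming first. -/
def nodeType (b : Bool) : List Bool → Bool
  | [] => b
  | d :: s => d && !nodeType b s

/-- Selects the gadget attached to a node of the tree of height `m`: that for `true` at the leaves
of type `true`, and that for `false` everywhere else. -/
def gadgetType (m : ℕ) (b : Bool) (s : List Bool) : Bool := decide (s.length = m) && nodeType b s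

/-- The color of the nodes of depth `n`. It identifies the root and tells parents from children. -/
def nodeColor : ℕ → Fin 4
  | 0 => 0
  | n + 1 => (Fin.ofNat 3 n).succ

theorem nodeColor_eq_zero_iff {n : ℕ} : nodeColor n = 0 ↔ n = 0 := by
  cases n <;> simp [nodeColor]

theorem nodeColor_add_two_ne (n : ℕ) : nodeColor (n + 2) ≠ nodeColor n := by
  cases n with
  | zero => simp [nodeColor]
  | succ n => simp only [nodeColor, ne_eq, Fin.ext_iff, Fin.val_succ, Fin.ofNat]; omega

variable {W : Type*}

/-- Adjacency in a binary tree with a graph `G s` attached to every node `s`: the node `s` itself is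
`(s, none)`, and the vertex `w` of `G s`, which is adjacent to it, is `(s, some w)`. -/
inductive TreeAdj (G : List Bool → SimpleGraph W) :
    List Bool → Option W → List Bool → Option W → Prop
  | child (s d) : TreeAdj G s none (d :: s) none
  | parent (s d) : TreeAdj G (d :: s) none s none
  | enter (s w) : TreeAdj G s none s (some w)
  | leave (s w) : TreeAdj G s (some w) s none
  | gadget {s w w'} (h : (G s).Adj w w') : TreeAdj G s (some w) s (some w')

namespace TreeAdj

variable {G : List Bool → SimpleGraph W} {s s' : List Bool} {o o' : Option W}

theorem symm (h : TreeAdj G s o s' o') : TreeAdj G s' o' s o := by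
  cases h with
  | gadget h => exact .gadget h.symm
  | _ => constructor

theorem irrefl : ¬ TreeAdj G s o s o := fun h => by
  cases h with
  | gadget h => exact h.ne rfl

end TreeAdj

/-- The vertices of two disjoint copies of a binary tree of height `m` with a copy of `W` attached
to every node. Duplicator answers in the second copy when a pebble is to be placed far from the
other one. -/
abbrev TreeVertex (m : ℕ) (W : Type*) : Type _ := Bool × {s : List Bool // s.length ≤ m} × Option W

/-- Two disjoint copies of the binary tree of height `m` with root of type `b`, where one of the
gadgets `D true` and `D false` is attached to each node. The first four colors are those of the
nodes, and the others those of the gadgets. -/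
def gadgetTree (m : ℕ) (D : Bool → ColoredGraph c W) (b : Bool) :
    ColoredGraph (4 + c) (TreeVertex m W) where
  graph :=
    { Adj u v := u.1 = v.1 ∧
        TreeAdj (fun s => (D (gadgetType m b s)).graph) u.2.1 u.2.2 v.2.1 v.2.2
      symm := ⟨fun _ _ h => ⟨h.1.symm, h.2.symm⟩⟩
      loopless := ⟨fun _ h => h.2.irrefl⟩ }
  color
    | (_, s, none) => Fin.castAdd c (nodeColor s.1.length)
    | (_, s, some w) => Fin.natAdd 4 ((D (gadgetType m b s)).color w)

/-! ### Duplicator's strategy on trees of gadgets -/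

/-- A pair of nodes of depth `l` and of types `x` and `y` that is good enough for Duplicator if
Spoiler is going to play from `x` and may change sides `a` times. -/
def TypesMatch (m a l : ℕ) (x y : Bool) : Prop := x ≠ y → l + a + y.toNat ≤ m

theorem TypesMatch.swap {m a l : ℕ} {x y : Bool} (h : TypesMatch m (a + 1) l x y) :
    TypesMatch m a l y x := by
  intro hyx
  have hle := h hyx.symm
  have hx := x.toNat_le
  omega

/-- Duplicator may keep pebbles on two nodes if, along the paths to them from the roots of types
`b` and `b'`, all types match. -/
inductive NodesMatch (m : ℕ) (b b' : Bool) (a : ℕ) : List Bool → List Bool → Prop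
  | root (h : TypesMatch m a 0 b b') : NodesMatch m b b' a [] []
  | child {s s' d d'} (hs : NodesMatch m b b' a s s')
      (h : TypesMatch m a (s.length + 1) (nodeType b (d :: s)) (nodeType b' (d' :: s'))) :
      NodesMatch m b b' a (d :: s) (d' :: s')

namespace NodesMatch

variable {m : ℕ} {b b' : Bool} {a : ℕ} {s s' : List Bool}

theorem length_eq (h : NodesMatch m b b' a s s') : s.length = s'.length := by
  induction h with
  | root => rfl
  | child _ _ ih => simp only [List.length_cons, ih]

theorem typesMatch (h : NodesMatch m b b' a s s') :
    TypesMatch m a s.length (nodeType b s) (nodeType b' s') := by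
  cases h <;> assumption

theorem typesMatch_root (h : NodesMatch m b b' a s s') : TypesMatch m a 0 b b' := by
  induction h <;> assumption

theorem swap (h : NodesMatch m b b' (a + 1) s s') : NodesMatch m b' b a s' s := by
  induction h with
  | root h => exact .root h.swap
  | child hs h ih => exact .child ih (hs.length_eq ▸ h.swap)

theorem gadgetType_le (h : NodesMatch m b b' a s s') : gadgetType m b' s' ≤ gadgetType m b s := by
  have htypes := h.typesMatch
  simp only [gadgetType, ← h.length_eq, Bool.le_iff_imp, Bool.and_eq_true, decide_eq_true_eq]
  rintro ⟨hm, hy⟩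
  refine ⟨hm, ?_⟩
  by_contra hx
  have hle := htypes (by simp_all)
  simp only [hy, Bool.toNat_true] at hle
  omega

/-- Duplicator answers by moving to the second child just if Spoiler moves to a node of type
`true`. -/
theorem exists_child (h : NodesMatch m b b' a s s') (d : Bool) :
    ∃ d', NodesMatch m b b' a (d :: s) (d' :: s') := by
  refine ⟨nodeType b (d :: s), h.child fun hne => ?_⟩
  have htypes := h.typesMatch
  simp only [nodeType, TypesMatch] at htypes hne ⊢
  cases d <;> cases hx : nodeType b s <;> cases hy : nodeType b' s' <;> simp_all
  omega

theorem exists_of_root (h : TypesMatch m a 0 b b') (s : List Bool) :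
    ∃ s', NodesMatch m b b' a s s' := by
  induction s with
  | nil => exact ⟨[], .root h⟩
  | cons d s ih =>
    obtain ⟨s', hs'⟩ := ih
    obtain ⟨d', hd'⟩ := hs'.exists_child d
    exact ⟨d' :: s', hd'⟩

end NodesMatch

/-- Duplicator may keep pebbles on vertices of the gadgets `D x` and `D y` if she can imitate walks
of length `t`. In equal gadgets she uses the same vertex. -/
def VerticesMatch (D : Bool → ColoredGraph c W) (t : ℕ) (x y : Bool) (w z : W) : Prop :=
  (D x).Sim (D y) t w z ∧ (x = y → w = z)

/-- The strategy of Duplicator on trees of gadgets, in games of at most `N` rounds. -/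
def TreeMatch (m N : ℕ) (D : Bool → ColoredGraph c W) (b b' : Bool) (a t : ℕ)
    (u v : TreeVertex m W) : Prop :=
  t ≤ N ∧ NodesMatch m b b' a u.2.1 v.2.1 ∧
    Option.Rel (VerticesMatch D t (gadgetType m b u.2.1) (gadgetType m b' v.2.1)) u.2.2 v.2.2

section Strategy

variable {D : Bool → ColoredGraph c W} {t N : ℕ} {x y : Bool} {w w' z : W}

theorem verticesMatch_refl (D : Bool → ColoredGraph c W) (t : ℕ) (x : Bool) (w : W) :
    VerticesMatch D t x x w w :=
  ⟨(D x).sim_refl t w, fun _ => rfl⟩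

theorem VerticesMatch.exists_adj (h : VerticesMatch D (t + 1) x y w z)
    (hw : (D x).graph.Adj w w') :
    ∃ z', (D y).graph.Adj z z' ∧ VerticesMatch D t x y w' z' := by
  by_cases hxy : x = y
  · subst hxy
    exact ⟨w', h.2 rfl ▸ hw, verticesMatch_refl D t x w'⟩
  · obtain ⟨z', hz, hsim⟩ := h.1.2 w' hw
    exact ⟨z', hz, hsim, fun h => absurd h hxy⟩

theorem exists_verticesMatch (hD : ∀ w, ∃ z, (D true).Sim (D false) N w z) (ht : t ≤ N)
    (hyx : y ≤ x) (w : W) : ∃ z, VerticesMatch D t x y w z := by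
  by_cases hxy : x = y
  · exact hxy ▸ ⟨w, verticesMatch_refl D t x w⟩
  · obtain ⟨rfl, rfl⟩ : x = true ∧ y = false := by revert x y; decide
    obtain ⟨z, hz⟩ := hD w
    exact ⟨z, hz.anti ht, fun h => absurd h hxy⟩

variable {m : ℕ} {b b' : Bool} {a : ℕ} {u v : TreeVertex m W}

theorem TreeMatch.swap (h : TreeMatch m N D b b' (a + 1) t u v) :
    TreeMatch m N D b' b a t v u := by
  obtain ⟨ht, hnodes, hvertices⟩ := h
  refine ⟨ht, hnodes.swap, ?_⟩
  rw [hnodes.swap.gadgetType_le.antisymm hnodes.gadgetType_le] at hvertices ⊢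
  generalize u.2.2 = o, v.2.2 = o' at hvertices
  cases hvertices with
  | none => exact .none
  | some h => exact .some (h.2 rfl ▸ verticesMatch_refl D t _ _)

theorem TreeMatch.color_eq (h : TreeMatch m N D b b' a t u v) :
    (gadgetTree m D b).color u = (gadgetTree m D b').color v := by
  obtain ⟨i, s, o⟩ := u
  obtain ⟨i', s', o'⟩ := v
  obtain ⟨-, hnodes, hvertices⟩ := h
  cases hvertices with
  | none => exact congrArg (Fin.castAdd c <| nodeColor ·) hnodes.length_eq
  | some h => exact congrArg (Fin.natAdd 4) h.1.color_eq

theorem TreeMatch.exists_adj (hD : ∀ w, ∃ z, (D true).Sim (D false) N w z)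
    (h : TreeMatch m N D b b' a (t + 1) u v) {u' : TreeVertex m W}
    (hu : (gadgetTree m D b).graph.Adj u u') :
    ∃ v', (gadgetTree m D b').graph.Adj v v' ∧ TreeMatch m N D b b' a t u' v' := by
  obtain ⟨i, ⟨s, hs⟩, o⟩ := u
  obtain ⟨i', ⟨s', hs'⟩, o'⟩ := u'
  obtain ⟨j, ⟨r, hr⟩, p⟩ := v
  obtain ⟨ht, hnodes, hvertices⟩ := h
  obtain ⟨-, hadj⟩ := hu
  replace ht := Nat.le_of_succ_le ht
  simp only at hnodes hvertices hadj
  cases hadj with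
  | child _ d =>
    cases hvertices
    obtain ⟨d', hd'⟩ := hnodes.exists_child d
    exact ⟨(j, ⟨d' :: r, hd'.length_eq ▸ hs'⟩, none), ⟨rfl, .child r d'⟩, ht, hd', .none⟩
  | parent _ d =>
    cases hvertices
    cases hnodes with
    | child hnodes =>
      exact ⟨(j, ⟨_, Nat.le_of_succ_le hr⟩, none), ⟨rfl, .parent _ _⟩, ht, hnodes, .none⟩
  | enter _ w =>
    cases hvertices
    obtain ⟨z, hz⟩ := exists_verticesMatch hD ht hnodes.gadgetType_le w
    exact ⟨(j, ⟨r, hr⟩, some z), ⟨rfl, .enter r z⟩, ht, hnodes, .some hz⟩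
  | leave _ w =>
    cases hvertices
    exact ⟨(j, ⟨r, hr⟩, none), ⟨rfl, .leave r _⟩, ht, hnodes, .none⟩
  | gadget hw =>
    cases hvertices with
    | some hwz =>
      obtain ⟨z', hz, hmatch⟩ := hwz.exists_adj hw
      exact ⟨(j, ⟨r, hr⟩, some z'), ⟨rfl, .gadget hz⟩, ht, hnodes, .some hmatch⟩

theorem exists_treeMatch (hD : ∀ w, ∃ z, (D true).Sim (D false) N w z) (ht : t ≤ N)
    (hroot : TypesMatch m a 0 b b') (i : Bool) (u : TreeVertex m W) :
    ∃ v : TreeVertex m W, v.1 = i ∧ TreeMatch m N D b b' a t u v := by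
  obtain ⟨j, ⟨s, hs⟩, o⟩ := u
  obtain ⟨s', hnodes⟩ := NodesMatch.exists_of_root hroot s
  have hs' : s'.length ≤ m := hnodes.length_eq ▸ hs
  cases o with
  | none => exact ⟨(i, ⟨s', hs'⟩, none), rfl, ht, hnodes, .none⟩
  | some w =>
    obtain ⟨z, hz⟩ := exists_verticesMatch hD ht hnodes.gadgetType_le w
    exact ⟨(i, ⟨s', hs'⟩, some z), rfl, ht, hnodes, .some hz⟩

theorem TreeMatch.of_succ (h : TreeMatch m N D b b' a (t + 1) u v) :
    TreeMatch m N D b b' a t u v := by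
  obtain ⟨ht, hnodes, hvertices⟩ := h
  refine ⟨Nat.le_of_succ_le ht, hnodes, ?_⟩
  generalize u.2.2 = o, v.2.2 = o' at hvertices
  cases hvertices with
  | none => exact .none
  | some h => exact .some ⟨h.1.anti t.le_succ, h.2⟩

theorem isStrategy_treeMatch (hD : ∀ w, ∃ z, (D true).Sim (D false) N w z) :
    IsStrategy (gadgetTree m D) (TreeMatch m N D) where
  swap := TreeMatch.swap
  color_eq := TreeMatch.color_eq
  move {b b' a t u v} h u' := by
    by_cases heq : u' = u
    · exact ⟨v, by simp [heq], by simp [heq], heq ▸ h.of_succ⟩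
    by_cases hadj : (gadgetTree m D b).graph.Adj u u'
    · obtain ⟨v', hv, hmatch⟩ := h.exists_adj hD hadj
      exact ⟨v', by simp [heq, hv.ne'], by simp [hadj, hv], hmatch⟩
    · obtain ⟨v', hv, hmatch⟩ :=
        exists_treeMatch hD (Nat.le_of_succ_le h.1) h.2.1.typesMatch_root (!v.1) u'
      have hne : v' ≠ v := fun h => by simp [h] at hv
      have hnadj : ¬ (gadgetTree m D b').graph.Adj v v' := fun h => by simp [h.1] at hv
      exact ⟨v', by simp [heq, hne], by simp [hadj, hnadj], hmatch⟩

theorem lt_distDepth_gadgetTree (hD : ∀ w, ∃ z, (D true).Sim (D false) N w z) (m : ℕ) :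
    (N : ℕ∞) < distDepth (PiLevel (4 + c) 2 (m + 1)) (gadgetTree m D false)
      (gadgetTree m D true) := by
  have hroot : TypesMatch m m 0 true false := fun _ => by simp
  obtain ⟨v, -, hv⟩ :=
    exists_treeMatch hD le_rfl hroot false (false, ⟨[], Nat.zero_le m⟩, none)
  exact (isStrategy_treeMatch hD).lt_distDepth_piLevel hv

end Strategy
/-! ### Tracing the type of the root -/

theorem castAdd_ne_natAdd {n : ℕ} (i : Fin n) (j : Fin c) : Fin.castAdd c i ≠ Fin.natAdd n j :=
  Fin.ne_of_val_ne (i.isLt.trans_le (Nat.le_add_right n j)).ne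

namespace Modal

variable {m : ℕ} {D : Bool → ColoredGraph c W} {b i : Bool} {s : List Bool}
  {hs : s.length ≤ m}

theorem sat_relabel_gadgetTree (φ : Modal c) (w : W) :
    (φ.relabel (Fin.natAdd 4)).Sat (gadgetTree m D b) (i, ⟨s, hs⟩, some w) ↔
      φ.Sat (D (gadgetType m b s)) w := by
  induction φ generalizing w with
  | top => rfl
  | neg _ ih => exact (ih w).not
  | dia j φ ih =>
    constructor
    · rintro ⟨⟨i', ⟨s', hs'⟩, o⟩, ⟨hi, hadj⟩, hj, hφ⟩
      obtain rfl : i = i' := hi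
      dsimp only at hadj
      cases o with
      | none => exact absurd hj (castAdd_ne_natAdd _ _)
      | some w' =>
        cases hadj with
        | gadget hadj => exact ⟨w', hadj, Fin.natAdd_injective _ _ hj, (ih w').1 hφ⟩
    · rintro ⟨w', hadj, hj, hφ⟩
      exact ⟨(i, ⟨s, hs⟩, some w'), ⟨rfl, .gadget hadj⟩, congrArg (Fin.natAdd 4) hj, (ih w').2 hφ⟩

theorem sat_dia_natAdd_gadgetTree (φ : Modal c) (j : Fin c) :
    (dia (Fin.natAdd 4 j) (φ.relabel (Fin.natAdd 4))).Sat (gadgetTree m D b) (i, ⟨s, hs⟩, none) ↔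
      φ.Realized j (D (gadgetType m b s)) := by
  constructor
  · rintro ⟨⟨i', ⟨s', hs'⟩, o⟩, ⟨hi, hadj⟩, hj, hφ⟩
    obtain rfl : i = i' := hi
    dsimp only at hadj
    cases o with
    | none => exact absurd hj (castAdd_ne_natAdd _ _)
    | some w =>
      cases hadj with
      | enter => exact ⟨w, Fin.natAdd_injective _ _ hj, (sat_relabel_gadgetTree φ w).1 hφ⟩
  · rintro ⟨w, hj, hφ⟩
    exact ⟨(i, ⟨s, hs⟩, some w), ⟨rfl, .enter _ w⟩, congrArg (Fin.natAdd 4) hj,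
      (sat_relabel_gadgetTree φ w).2 hφ⟩

theorem sat_dia_nodeColor_gadgetTree (φ : Modal (4 + c)) :
    (dia (Fin.castAdd c (nodeColor (s.length + 1))) φ).Sat (gadgetTree m D b) (i, ⟨s, hs⟩, none) ↔
      ∃ (d : Bool) (h : (d :: s).length ≤ m),
        φ.Sat (gadgetTree m D b) (i, ⟨d :: s, h⟩, none) := by
  constructor
  · rintro ⟨⟨i', ⟨s', hs'⟩, o⟩, ⟨hi, hadj⟩, hj, hφ⟩
    obtain rfl : i = i' := hi
    dsimp only at hadj
    cases hadj with
    | child _ d => exact ⟨d, hs', hφ⟩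
    | parent _ d =>
      exact absurd (Fin.castAdd_injective _ _ hj) (nodeColor_add_two_ne _).symm
    | enter _ w => exact absurd hj.symm (castAdd_ne_natAdd _ _)
  · rintro ⟨d, h, hφ⟩
    exact ⟨(i, ⟨d :: s, h⟩, none), ⟨rfl, .child _ d⟩, rfl, hφ⟩

/-- The formula saying that a node at distance `h` from the leaves and `l` from the root has type
`false`, if the gadgets for `true` and for `false` are told apart by `φ.Realized j`. -/
def typeFalse (φ : Modal c) (j : Fin c) : ℕ → ℕ → Modal (4 + c)
  | 0, _ => neg (dia (Fin.natAdd 4 j) (φ.relabel (Fin.natAdd 4)))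
  | h + 1, l => dia (Fin.castAdd c (nodeColor (l + 1))) (neg (typeFalse φ j h (l + 1)))

theorem altAfter_all_typeFalse (φ : Modal c) (j : Fin c) (h l : ℕ) :
    (typeFalse φ j h l).altAfter .all = h + φ.altAfter .ex := by
  induction h generalizing l with
  | zero => simp [typeFalse, altAfter, altAfter_relabel, Quantifier.dual]
  | succ h ih => simp [typeFalse, altAfter, Quantifier.dual, ih]; omega

theorem altAfter_ex_typeFalse_succ (φ : Modal c) (j : Fin c) (h l : ℕ) :
    (typeFalse φ j (h + 1) l).altAfter .ex = h + φ.altAfter .ex := by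
  simp [typeFalse, altAfter, Quantifier.dual, altAfter_all_typeFalse]

variable {φ : Modal c} {j : Fin c}

theorem sat_typeFalse (htrue : φ.Realized j (D true)) (hfalse : ¬ φ.Realized j (D false)) {h : ℕ}
    (hm : s.length + h = m) :
    (typeFalse φ j h s.length).Sat (gadgetTree m D b) (i, ⟨s, hs⟩, none) ↔
      nodeType b s = false := by
  induction h generalizing s with
  | zero =>
    have hgadget : gadgetType m b s = nodeType b s := by simp [gadgetType, ← hm]
    rw [typeFalse, Sat, sat_dia_natAdd_gadgetTree, hgadget]
    cases nodeType b s <;> simp [htrue, hfalse]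
  | succ h ih =>
    have hchild (d : Bool) (hd : (d :: s).length ≤ m) :
        (neg (typeFalse φ j h (s.length + 1))).Sat (gadgetTree m D b)
          (i, ⟨d :: s, hd⟩, none) ↔ d = true ∧ nodeType b s = false := by
      have hsat := @ih (d :: s) hd (by simp only [List.length_cons]; omega)
      rw [Sat, ← List.length_cons, hsat]
      simp [nodeType]
    rw [typeFalse, sat_dia_nodeColor_gadgetTree]
    refine ⟨fun ⟨d, hd, hsat⟩ => ((hchild d hd).1 hsat).2, fun htype => ?_⟩
    have hlt : (true :: s).length ≤ m := by simp only [List.length_cons]; omega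
    exact ⟨true, hlt, (hchild true hlt).2 ⟨rfl, htype⟩⟩

theorem realized_typeFalse (htrue : φ.Realized j (D true)) (hfalse : ¬ φ.Realized j (D false)) :
    (typeFalse φ j m 0).Realized (Fin.castAdd c (nodeColor 0)) (gadgetTree m D b) ↔ b = false := by
  constructor
  · rintro ⟨⟨i, ⟨s, hs⟩, o⟩, hcolor, hsat⟩
    cases o with
    | some w => exact absurd hcolor.symm (castAdd_ne_natAdd _ _)
    | none =>
      obtain rfl : s = [] :=
        List.length_eq_zero_iff.1 (nodeColor_eq_zero_iff.1 (Fin.castAdd_injective _ _ hcolor))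
      exact (sat_typeFalse (s := []) htrue hfalse (Nat.zero_add m)).1 hsat
  · intro hb
    exact ⟨(false, ⟨[], Nat.zero_le m⟩, none), rfl,
      (sat_typeFalse (s := []) htrue hfalse (Nat.zero_add m)).2 hb⟩

/-- The sentence saying that the root of a tree of gadgets of height `m` has type `false`. -/
def rootFalse (φ : Modal c) (j : Fin c) (m : ℕ) : Formula (4 + c) 2 :=
  (typeFalse φ j m 0).toSentence (Fin.castAdd c (nodeColor 0))

theorem distDepth_gadgetTree_le (htrue : φ.Realized j (D true))
    (hfalse : ¬ φ.Realized j (D false)) {i : ℕ} (hi : m + φ.altAfter .ex < i) :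
    distDepth (SigmaLevel (4 + c) 2 i) (gadgetTree (m + 1) D false) (gadgetTree (m + 1) D true) ≤
      ((φ.rootFalse j (m + 1)).depth : ℕ∞) :=
  distDepth_sigmaLevel_le ((realized_typeFalse htrue hfalse).2 rfl)
    (by simp [realized_typeFalse htrue hfalse]) ((altAfter_ex_typeFalse_succ φ j m 0).trans_lt hi)

end Modal

/-! ### The gadget of two cycles -/

/-- The residue modulo `3` of a residue modulo `3 * n`. -/
def residue (n : ℕ) : ZMod (3 * n) →+* ZMod 3 := ZMod.castHom (Nat.dvd_mul_right 3 n) (ZMod 3)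

theorem circulantGraph_one_adj_iff {n : ℕ} {x y : ZMod (3 * n)} :
    (SimpleGraph.circulantGraph {1}).Adj x y ↔ y = x + 1 ∨ x = y + 1 := by
  have hne (z : ZMod (3 * n)) : z ≠ z + 1 := fun h => by
    have hres := congrArg (residue n) h
    simp at hres
  simp only [SimpleGraph.circulantGraph_adj, Set.mem_singleton_iff, sub_eq_iff_eq_add']
  refine ⟨fun h => h.2.symm, fun h => ⟨?_, h.symm⟩⟩
  rintro rfl
  exact h.elim (hne x) (hne x)

/-- The colors of gadgets record a residue modulo `3` and a mark. -/
noncomputable def gadgetColor : ZMod 3 × Bool ≃ Fin 6 := Fintype.equivFinOfCardEq rfl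

/-- The gadget for the type `x`: a cycle whose vertex `0` is marked if `x = true`, and a cycle with
two copies `(y, true)` and `(y, false)` of every vertex `y`, the first of which is marked unless
`y = 0`. The residues modulo `3` in the colors orient the cycles. -/
noncomputable def cycleGadget (p q : ℕ) (x : Bool) :
    ColoredGraph 6 (ZMod (3 * p) ⊕ ZMod (3 * q) × Bool) where
  graph := SimpleGraph.circulantGraph {1} ⊕g (SimpleGraph.circulantGraph {1}).comap Prod.fst
  color
    | .inl z => gadgetColor (residue p z, decide (z = 0) && x)
    | .inr (y, d) => gadgetColor (residue q y, decide (y ≠ 0) && d)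

/-- The color of the vertex `T` on the first cycle of the gadget for `true`. -/
noncomputable def patternColor (p T : ℕ) : Fin 6 := gadgetColor (T, decide (3 * p ∣ T))

section CycleGadget

variable {p q : ℕ} {x x' : Bool}

theorem cycleGadget_adj_inl {z : ZMod (3 * p)} {v : ZMod (3 * p) ⊕ ZMod (3 * q) × Bool} :
    (cycleGadget p q x).graph.Adj (.inl z) v ↔ ∃ z', v = .inl z' ∧ (z' = z + 1 ∨ z = z' + 1) := by
  cases v <;> simp [cycleGadget, circulantGraph_one_adj_iff, -SimpleGraph.circulantGraph_adj]

theorem cycleGadget_adj_inr {y : ZMod (3 * q)} {d : Bool}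
    {v : ZMod (3 * p) ⊕ ZMod (3 * q) × Bool} :
    (cycleGadget p q x).graph.Adj (.inr (y, d)) v ↔
      ∃ y' d', v = .inr (y', d') ∧ (y' = y + 1 ∨ y = y' + 1) := by
  rcases v with z | ⟨y', d'⟩ <;>
    simp [cycleGadget, circulantGraph_one_adj_iff, -SimpleGraph.circulantGraph_adj]

theorem cycleGadget_true_color_natCast (T : ℕ) :
    (cycleGadget p q true).color (.inl T) = patternColor p T := by
  simp [cycleGadget, patternColor, ZMod.natCast_eq_zero_iff]

theorem cycleGadget_color_natCast (hpq : p.Coprime q) {T : ℕ} (h0 : 0 < T) (hT : T < 3 * p * q) :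
    (cycleGadget p q x).color (.inr (T, decide (3 * p ∣ T))) = patternColor p T := by
  have hndvd : 3 * q ∣ T → ¬ 3 * p ∣ T := fun ⟨a, ha⟩ ⟨b, hb⟩ => by
    subst ha
    have hdvd : p ∣ a := hpq.dvd_of_dvd_mul_left ⟨b, by linarith⟩
    refine hT.not_ge (Nat.le_of_dvd h0 ?_)
    rw [mul_right_comm]
    exact mul_dvd_mul_left _ hdvd
  simpa [cycleGadget, patternColor, ZMod.natCast_eq_zero_iff] using fun h h' => hndvd h' h

/-! ### Simulating the gadget for `true` -/

theorem sim_inr (t : ℕ) (v : ZMod (3 * q) × Bool) :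
    (cycleGadget p q x).Sim (cycleGadget p q x') t (.inr v) (.inr v) := by
  induction t generalizing v with
  | zero => rfl
  | succ t ih =>
    refine ⟨rfl, fun u hu => ?_⟩
    obtain ⟨y, d, rfl, -⟩ := cycleGadget_adj_inr.1 hu
    exact ⟨_, hu, ih _⟩

theorem sim_natCast (hpq : p.Coprime q) {t T : ℕ} (ht : t < T) (hT : T + t < 3 * p * q) :
    (cycleGadget p q true).Sim (cycleGadget p q false) t (.inl T)
      (.inr (T, decide (3 * p ∣ T))) := by
  have hcolor {T : ℕ} (h0 : 0 < T) (hT : T < 3 * p * q) :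
      (cycleGadget p q true).color (.inl T) =
        (cycleGadget p q false).color (.inr (T, decide (3 * p ∣ T))) := by
    rw [cycleGadget_true_color_natCast, cycleGadget_color_natCast hpq h0 hT]
  induction t generalizing T with
  | zero => exact hcolor ht hT
  | succ t ih =>
    refine ⟨hcolor (by omega) (by omega), fun u hu => ?_⟩
    obtain ⟨z, rfl, hz⟩ := cycleGadget_adj_inl.1 hu
    obtain ⟨S, rfl, hST⟩ : ∃ S : ℕ, z = S ∧ (S = T + 1 ∨ T = S + 1) := by
      obtain ⟨T, rfl⟩ := Nat.exists_eq_add_of_lt ht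
      rcases hz with rfl | hz
      · exact ⟨_, (Nat.cast_succ _).symm, .inl rfl⟩
      · exact ⟨_, add_right_cancel (hz.symm.trans (Nat.cast_succ _)), .inr rfl⟩
    refine ⟨_, cycleGadget_adj_inr.2 ⟨S, decide (3 * p ∣ S), rfl, ?_⟩, ih (by omega) (by omega)⟩
    exact_mod_cast hST.imp (congrArg _) (congrArg (Nat.cast : ℕ → ZMod (3 * q)))

theorem exists_sim (hpq : p.Coprime q) (hp : p ≠ 0) {t : ℕ} (ht : 2 * t + 3 * p < 3 * p * q)
    (w : ZMod (3 * p) ⊕ ZMod (3 * q) × Bool) :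
    ∃ z, (cycleGadget p q true).Sim (cycleGadget p q false) t w z := by
  rcases w with z | v
  · have : NeZero (3 * p) := ⟨by omega⟩
    have hlt := (z - ((t + 1 : ℕ) : ZMod (3 * p))).val_lt
    obtain ⟨T, hT, htT, hTt⟩ : ∃ T : ℕ, (T : ZMod (3 * p)) = z ∧ t < T ∧ T + t < 3 * p * q :=
      ⟨t + 1 + (z - ((t + 1 : ℕ) : ZMod (3 * p))).val,
        by rw [Nat.cast_add, ZMod.natCast_zmod_val, add_sub_cancel], by omega, by omega⟩
    exact hT ▸ ⟨_, sim_natCast hpq htT hTt⟩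
  · exact ⟨_, sim_inr t v⟩

/-! ### Telling the gadgets apart -/

namespace Modal

/-- The formula saying that a vertex has no unmarked neighbor of residue `0`. -/
noncomputable def noUnmarked : Modal 6 := neg (dia (gadgetColor (0, false)) top)

theorem altAfter_ex_noUnmarked : noUnmarked.altAfter .ex = 1 := rfl

theorem realized_noUnmarked (p q : ℕ) :
    noUnmarked.Realized (gadgetColor (2, false)) (cycleGadget p q true) := by
  have hres : residue p (-1) = 2 := by rw [map_neg, map_one]; rfl
  have hne : (-1 : ZMod (3 * p)) ≠ 0 := fun h => by
    rw [h, map_zero] at hres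
    exact absurd hres (by decide)
  refine ⟨.inl (-1), by simp [cycleGadget, hres, hne], ?_⟩
  rintro ⟨v, hadj, hcolor, -⟩
  obtain ⟨z, rfl, hz⟩ := cycleGadget_adj_inl.1 hadj
  simp only [cycleGadget, EmbeddingLike.apply_eq_iff_eq, Prod.mk.injEq] at hcolor
  rcases hz with rfl | hz
  · simp at hcolor
  · rw [hz, map_add, hcolor.1, map_one] at hres
    exact absurd hres (by decide)

theorem not_realized_noUnmarked (p q : ℕ) :
    ¬ noUnmarked.Realized (gadgetColor (2, false)) (cycleGadget p q false) := by
  have htwo : (2 + 1 : ZMod 3) = 0 := by decide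
  rintro ⟨z | ⟨y, d⟩, hcolor, hno⟩ <;>
    simp only [cycleGadget, EmbeddingLike.apply_eq_iff_eq, Prod.mk.injEq] at hcolor
  · exact hno ⟨.inl (z + 1), cycleGadget_adj_inl.2 ⟨_, rfl, .inl rfl⟩,
      by simp [cycleGadget, hcolor, htwo], trivial⟩
  · exact hno ⟨.inr (y + 1, false), cycleGadget_adj_inr.2 ⟨_, _, rfl, .inl rfl⟩,
      by simp [cycleGadget, hcolor, htwo], trivial⟩

/-- The formula saying that a walk of length `n` starts at a vertex and has the colors of the path
that leads from the vertex `T` around the first cycle of the gadget for `true`. -/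
noncomputable def walk (p : ℕ) : ℕ → ℕ → Modal 6
  | 0, _ => top
  | n + 1, T => dia (patternColor p (T + 1)) (walk p n (T + 1))

theorem altAfter_ex_walk (p n T : ℕ) : (walk p n T).altAfter .ex = 0 := by
  induction n generalizing T with
  | zero => rfl
  | succ n ih => simp [walk, altAfter, ih]

theorem sat_walk (n T : ℕ) : (walk p n T).Sat (cycleGadget p q true) (.inl T) := by
  induction n generalizing T with
  | zero => trivial
  | succ n ih =>
    exact ⟨.inl (T + 1 : ℕ), cycleGadget_adj_inl.2 ⟨_, rfl, .inl (Nat.cast_succ T)⟩,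
      cycleGadget_true_color_natCast _, ih _⟩

theorem exists_color_eq_of_sat_walk {n T l : ℕ} {y : ZMod (3 * q)} {d : Bool}
    (hcolor : (cycleGadget p q x).color (.inr (y, d)) = patternColor p T)
    (hwalk : (walk p n T).Sat (cycleGadget p q x) (.inr (y, d))) (hl : l ≤ n) :
    ∃ d', (cycleGadget p q x).color (.inr (y + l, d')) = patternColor p (T + l) := by
  induction l generalizing n T y d with
  | zero => exact ⟨d, by simpa using hcolor⟩
  | succ l ih =>
    obtain ⟨n, rfl⟩ := Nat.exists_eq_add_of_le' (Nat.le_trans (Nat.le_add_left 1 l) hl)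
    obtain ⟨v, hadj, hv, hwalk⟩ := hwalk
    obtain ⟨y', d', rfl, rfl | hy⟩ := cycleGadget_adj_inr.1 hadj
    · obtain ⟨e, he⟩ := ih hv hwalk (Nat.le_of_succ_le_succ hl)
      refine ⟨e, ?_⟩
      rwa [Nat.cast_succ, ← add_assoc, add_right_comm, ← add_assoc, add_right_comm T]
    · simp only [cycleGadget, patternColor, EmbeddingLike.apply_eq_iff_eq, Prod.mk.injEq]
        at hv hcolor
      have hres := hcolor.1
      rw [hy, map_add, map_one, hv.1, Nat.cast_succ, add_assoc, add_eq_left] at hres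
      exact absurd hres (by decide)

theorem exists_dvd_add_eq_zero (hpq : p.Coprime q) (hq : q ≠ 0) {y : ZMod (3 * q)}
    (hy : residue q y = 0) : ∃ l ≤ 3 * p * q, 3 * p ∣ l ∧ y + (l : ZMod (3 * q)) = 0 := by
  have : NeZero q := ⟨hq⟩
  obtain ⟨b, rfl⟩ : ∃ b : ℕ, y = (3 * b : ℕ) := by
    rw [← ZMod.natCast_zmod_val y, map_natCast, ZMod.natCast_eq_zero_iff] at hy
    obtain ⟨b, hb⟩ := hy
    exact ⟨b, by rw [← hb, ZMod.natCast_zmod_val]⟩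
  have hmod : ((p * (-b * (p : ZMod q)⁻¹).val : ℕ) : ZMod q) = -b := by
    rw [Nat.cast_mul, ZMod.natCast_zmod_val, mul_left_comm, ZMod.coe_mul_inv_eq_one p hpq, mul_one]
  refine ⟨3 * (p * (-b * (p : ZMod q)⁻¹).val), ?_, ⟨_, (mul_assoc _ _ _).symm⟩, ?_⟩
  · rw [mul_assoc]
    gcongr
    exact (ZMod.val_lt _).le
  · rw [← Nat.cast_add, ← mul_add, ZMod.natCast_eq_zero_iff]
    refine mul_dvd_mul_left 3 ((ZMod.natCast_eq_zero_iff _ _).1 ?_)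
    rw [Nat.cast_add, hmod, add_neg_cancel]

theorem realized_walk (p q n : ℕ) :
    (walk p n 0).Realized (patternColor p 0) (cycleGadget p q true) :=
  ⟨.inl (0 : ℕ), cycleGadget_true_color_natCast 0, sat_walk n 0⟩

theorem not_realized_walk (hpq : p.Coprime q) (hq : q ≠ 0) :
    ¬ (walk p (3 * p * q) 0).Realized (patternColor p 0) (cycleGadget p q false) := by
  rintro ⟨z | ⟨y, d⟩, hcolor, hwalk⟩
  · simp [cycleGadget, patternColor] at hcolor
  · have hy : residue q y = 0 := by
      simp only [cycleGadget, patternColor, EmbeddingLike.apply_eq_iff_eq, Prod.mk.injEq] at hcolor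
      simpa using hcolor.1
    obtain ⟨l, hl, hdvd, hzero⟩ := exists_dvd_add_eq_zero hpq hq hy
    obtain ⟨d', hd'⟩ := exists_color_eq_of_sat_walk hcolor hwalk hl
    simp [cycleGadget, patternColor, hzero, hdvd] at hd'

end Modal

end CycleGadget
/-! ### The size of the graphs -/

instance finite_node (m : ℕ) : Finite {s : List Bool // s.length ≤ m} :=
  (List.finite_length_le Bool m).to_subtype

theorem card_node_pos (m : ℕ) : 0 < Nat.card {s : List Bool // s.length ≤ m} := by
  have : Nonempty {s : List Bool // s.length ≤ m} := ⟨⟨[], Nat.zero_le m⟩⟩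
  exact Nat.card_pos

theorem card_treeVertex_cycleGadget (m : ℕ) {p q : ℕ} (hp : p ≠ 0) (hq : q ≠ 0) :
    Nat.card (TreeVertex m (ZMod (3 * p) ⊕ ZMod (3 * q) × Bool)) =
      2 * Nat.card {s : List Bool // s.length ≤ m} * (3 * p + 6 * q + 1) := by
  have : NeZero (3 * p) := ⟨by omega⟩
  have : NeZero (3 * q) := ⟨by omega⟩
  rw [Nat.card_prod, Nat.card_prod, Finite.card_option, Nat.card_sum, Nat.card_prod, Nat.card_zmod,
    Nat.card_zmod, Nat.card_eq_fintype_card (α := Bool), Fintype.card_bool]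
  ring

theorem nonempty_fin_equiv_treeVertex_cycleGadget {m C : ℕ}
    (hC : C = Nat.card {s : List Bool // s.length ≤ m}) {p q : ℕ} (hp : p ≠ 0) (hq : q ≠ 0) :
    Nonempty (Fin (2 * C * (3 * p + 6 * q + 1)) ≃
      TreeVertex m (ZMod (3 * p) ⊕ ZMod (3 * q) × Bool)) := by
  have : NeZero (3 * p) := ⟨by omega⟩
  have : NeZero (3 * q) := ⟨by omega⟩
  exact ⟨(Finite.equivFinOfCardEq (hC ▸ card_treeVertex_cycleGadget m hp hq)).symm⟩

theorem sq_lt_distDepth_gadgetTree_cycleGadget (m : ℕ) {q : ℕ} (hq : 2 ≤ q) :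
    ((q ^ 2 : ℕ) : ℕ∞) < distDepth (PiLevel (4 + 6) 2 (m + 1))
      (gadgetTree m (cycleGadget (q + 1) q) false) (gadgetTree m (cycleGadget (q + 1) q) true) :=
  lt_distDepth_gadgetTree
    (exists_sim (Nat.coprime_self_add_left.2 q.coprime_one_left) q.succ_ne_zero (by nlinarith)) m

theorem one_div_sq_mul_card_sq_le {C q : ℕ} (hC : 0 < C) (hq : 2 ≤ q) :
    1 / (22 * (C : ℝ)) ^ 2 * ((2 * C * (3 * (q + 1) + 6 * q + 1) : ℕ) : ℝ) ^ 2 ≤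
      ((q ^ 2 : ℕ) : ℝ) := by
  have hle : 2 * C * (3 * (q + 1) + 6 * q + 1) ≤ 22 * C * q := by nlinarith
  rw [one_div, inv_mul_le_iff₀ (by positivity), Nat.cast_pow, ← mul_pow]
  exact pow_le_pow_left₀ (by positivity) (by exact_mod_cast hle) 2

theorem ofReal_le_distDepth_gadgetTree_cycleGadget {m C q : ℕ}
    (hC : C = Nat.card {s : List Bool // s.length ≤ m}) (hq : 2 ≤ q) :
    ENNReal.ofReal
        (1 / (22 * (C : ℝ)) ^ 2 * ((2 * C * (3 * (q + 1) + 6 * q + 1) : ℕ) : ℝ) ^ 2) ≤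
      (distDepth (PiLevel (4 + 6) 2 (m + 1)) (gadgetTree m (cycleGadget (q + 1) q) false)
        (gadgetTree m (cycleGadget (q + 1) q) true) : ℝ≥0∞) := by
  refine (ENNReal.ofReal_le_ofReal (one_div_sq_mul_card_sq_le (hC ▸ card_node_pos m) hq)).trans ?_
  rw [ENNReal.ofReal_natCast, ← ENat.toENNReal_coe]
  exact ENat.toENNReal_le.2 (sq_lt_distDepth_gadgetTree_cycleGadget m hq).le

end AltHier

open AltHier in
theorem theorem7 :
    ∃ c : ℕ, ∀ i : ℕ, 2 ≤ i →
      ∃ (K : ℕ) (ε : ℝ), 0 < ε ∧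
        {n : ℕ | ∃ G H : AltHier.ColoredGraph c (Fin n),
          AltHier.distDepth (AltHier.SigmaLevel c 2 i) G H ≤ (K : ℕ∞) ∧
          AltHier.distDepth (AltHier.SigmaLevel c 2 (i - 1)) G H < ⊤ ∧
          ENNReal.ofReal (ε * (n : ℝ) ^ 2) ≤
            ((AltHier.distDepth (AltHier.PiLevel c 2 i) G H : ℕ∞) : ℝ≥0∞)}.Infinite := by
  refine ⟨4 + 6, fun i hi => ?_⟩
  obtain ⟨m, rfl⟩ := Nat.exists_eq_add_of_le' hi
  obtain ⟨C, hC⟩ : ∃ C, C = Nat.card {s : List Bool // s.length ≤ m + 1} := ⟨_, rfl⟩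
  have hC₀ : 0 < C := hC ▸ card_node_pos (m + 1)
  refine ⟨(Modal.noUnmarked.rootFalse (gadgetColor (2, false)) (m + 1)).depth,
    1 / (22 * (C : ℝ)) ^ 2, by positivity,
    Set.infinite_of_injective_forall_mem (f := fun r => 2 * C * (3 * (r + 2 + 1) + 6 * (r + 2) + 1))
      (fun r r' h => by linarith [Nat.eq_of_mul_eq_mul_left (by omega) h]) fun r => ?_⟩
  generalize hq : r + 2 = q
  obtain ⟨e⟩ := nonempty_fin_equiv_treeVertex_cycleGadget hC q.succ_ne_zero (q := q) (by omega)
  refine ⟨(gadgetTree (m + 1) (cycleGadget (q + 1) q) false).comap e,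
    (gadgetTree (m + 1) (cycleGadget (q + 1) q) true).comap e, ?_, ?_, ?_⟩ <;>
    rw [ColoredGraph.distDepth_comap]
  · exact Modal.distDepth_gadgetTree_le (Modal.realized_noUnmarked _ _)
      (Modal.not_realized_noUnmarked _ _) (by simp [Modal.altAfter_ex_noUnmarked])
  · exact (Modal.distDepth_gadgetTree_le (Modal.realized_walk _ _ _)
      (Modal.not_realized_walk (Nat.coprime_self_add_left.2 q.coprime_one_left) (by omega))
      (by simp [Modal.altAfter_ex_walk])).trans_lt (ENat.natCast_lt_top _)
  · exact ofReal_le_distDepth_gadgetTree_cycleGadget hC (by omega)
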